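/- Let $X_1, X_2, \ldots$ be independent identically distributed real random variables, and let $X$ have their common distribution. Let $f_1, \ldots, f_m : \mathbb R \to \mathbb R$ be (Borel) functions with $\mathbb E[f_i(X)^4] < \infty$ for all $i$, whose covariance matrix $\mathcal Q = (\mathrm{Cov}(f_i(X), f_j(X)))_{i,j=1}^m$ is positive definite (the $f_i(X)$ may be correlated). Fix an integer $K \ge 0$ and a constant $c > 0$. For a sample of size $N > K$ and a lag $0 \le k \le K$ put $$\hat m(f) = \frac1N\sum_{i=1}^N f(X_i),\qquad \hat s^2(f) = \frac1N\sum_{i=1}^N (f(X_i)-\hat m(f))^2,$$ $$\hat\gamma_k(f,g) = \frac1{N-k}\sum_{i=1}^{N-k}(f(X_i)-\hat m(f))(g(X_{i+k})-\hat m(g)),\qquad \hat\rho_k(f,g) = \frac{\hat\gamma_k(f,g)}{\hat s(f)\hat s(g)}.$$ Consider the vectors in $\mathbb R^{m^2}$ $$\hat{\mathbb Q}_k = [\hat\gamma_k(f_i,f_j)]_{i,j=1}^m,\qquad \hat{\mathbb C}_k = [\hat\rho_k(f_i,f_j)]_{i,j=1}^m,\qquad k = 1,\ldots,K,$$ and the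 $m\times m$ matrices $\hat{\mathcal Q} = (\hat\gamma_0(f_i,f_j))_{i,j}$ and $\hat{\mathcal C} = (\hat\rho_0(f_i,f_j))_{i,j}$. Let $\hat{\mathbf C} = \hat{\mathcal C}\otimes\hat{\mathcal C}$ (Kronecker product), and define $$\tilde{\mathbb T}_N = N\sum_{k=1}^K \hat{\mathbb C}_k'\hat{\mathbf C}^{-1}\hat{\mathbb C}_k,\qquad \tilde{\mathbb L}_N = N(N+c)\sum_{k=1}^K \frac{1}{N-k}\hat{\mathbb C}_k'\hat{\mathbf C}^{-1}\hat{\mathbb C}_k,$$ where the statistics are set to $0$ if $\hat{\mathbf C}$ is undefined or singular. Then, as $N\to\infty$, both $\tilde{\mathbb T}_N$ and $\tilde{\mathbb L}_N$ converge weakly to the chi-squared distribution $\chi^2_{m^2K}$ with $m^2K$ degrees of freedom. The same two convergences hold if, in the definitions of $\tilde{\mathbb T}_N$ and $\tilde{\mathbb L}_N$, every $\hat{\mathbb C}_k$ is replaced by $\hat{\mathbb Q}_k$ and $\hat{\mathcal C}$ by $\hat{\mathcal Q}$ (again with value $0$ if $\hat{\mathcal Q}\otimes\hat{\mathcal Q}$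 is singular). -/

import Mathlib

open MeasureTheory ProbabilityTheory Filter
open scoped Matrix Kronecker

noncomputable section

namespace IIDTest

/-! Observations are indexed from `0`: `x i` is the `(i+1)`-st observation, so that the first `N`
observations are `x 0, …, x (N - 1)`. -/

/-- Empirical mean of `f` over the first `N` observations. -/
def empMean (f : ℝ → ℝ) (x : ℕ → ℝ) (N : ℕ) : ℝ :=
  (1 / (N : ℝ)) * ∑ i ∈ Finset.range N, f (x i)

/-- Empirical standard deviation of `f` over the first `N` observations (normalized by `N`). -/
def empStd (f : ℝ → ℝ) (x : ℕ → ℝ) (N : ℕ) : ℝ :=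
  √((1 / (N : ℝ)) * ∑ i ∈ Finset.range N, (f (x i) - empMean f x N) ^ 2)

/-- Empirical cross-covariance of `f` and `g` with lag `k`. -/
def empCov (k : ℕ) (f g : ℝ → ℝ) (x : ℕ → ℝ) (N : ℕ) : ℝ :=
  (1 / ((N : ℝ) - (k : ℝ))) *
    ∑ i ∈ Finset.range (N - k), (f (x i) - empMean f x N) * (g (x (i + k)) - empMean g x N)

/-- Empirical cross-correlation of `f` and `g` with lag `k`. -/
def empCorr (k : ℕ) (f g : ℝ → ℝ) (x : ℕ → ℝ) (N : ℕ) : ℝ :=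
  empCov k f g x N / (empStd f x N * empStd g x N)

variable {m : ℕ}

/-- The `m²`-dimensional vector of empirical auto- and cross-covariances with lag `k`. -/
def covVec (f : Fin m → ℝ → ℝ) (x : ℕ → ℝ) (N k : ℕ) : Fin m × Fin m → ℝ :=
  fun p => empCov k (f p.1) (f p.2) x N

/-- The `m²`-dimensional vector of empirical auto- and cross-correlations with lag `k`. -/
def corrVec (f : Fin m → ℝ → ℝ) (x : ℕ → ℝ) (N k : ℕ) : Fin m × Fin m → ℝ :=
  fun p => empCorr k (f p.1) (f p.2) x N

/-- The empirical covariance matrix of `f₁, …, f_m` (lag zero). -/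
def covMat (f : Fin m → ℝ → ℝ) (x : ℕ → ℝ) (N : ℕ) : Matrix (Fin m) (Fin m) ℝ :=
  Matrix.of fun i j => empCov 0 (f i) (f j) x N

/-- The empirical correlation matrix of `f₁, …, f_m` (lag zero). -/
def corrMat (f : Fin m → ℝ → ℝ) (x : ℕ → ℝ) (N : ℕ) : Matrix (Fin m) (Fin m) ℝ :=
  Matrix.of fun i j => empCorr 0 (f i) (f j) x N

/-- The quadratic form `v' (A ⊗ A)⁻¹ v`; it is zero when `A ⊗ A` is singular. -/
def kronQuad (A : Matrix (Fin m) (Fin m) ℝ) (v : Fin m × Fin m → ℝ) : ℝ :=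
  v ⬝ᵥ ((A ⊗ₖ A)⁻¹ *ᵥ v)

/-- The Box–Pierce type statistic `N ∑ₖ vₖ' (A ⊗ A)⁻¹ vₖ`. -/
def statT (K N : ℕ) (A : Matrix (Fin m) (Fin m) ℝ) (v : ℕ → Fin m × Fin m → ℝ) : ℝ :=
  (N : ℝ) * ∑ k ∈ Finset.Icc 1 K, kronQuad A (v k)

/-- The Ljung–Box type statistic `N (N + c) ∑ₖ vₖ' (A ⊗ A)⁻¹ vₖ / (N - k)`. -/
def statL (K N : ℕ) (c : ℝ) (A : Matrix (Fin m) (Fin m) ℝ) (v : ℕ → Fin m × Fin m → ℝ) : ℝ :=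
  (N : ℝ) * ((N : ℝ) + c) *
    ∑ k ∈ Finset.Icc 1 K, (1 / ((N : ℝ) - (k : ℝ))) * kronQuad A (v k)

/-- The theoretical covariance matrix of the random vector `(f₁(Y), …, f_m(Y))`. -/
def popCovMat {Ω : Type*} [MeasurableSpace Ω] (P : Measure Ω) (f : Fin m → ℝ → ℝ) (Y : Ω → ℝ) :
    Matrix (Fin m) (Fin m) ℝ :=
  Matrix.of fun i j => covariance (fun ω => f i (Y ω)) (fun ω => f j (Y ω)) P

/-- The chi-squared distribution with `n` degrees of freedom: the law of the sum of squares of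
`n` independent standard normal random variables. -/
def chiSq (n : ℕ) : Measure ℝ :=
  (Measure.pi fun _ : Fin n => gaussianReal 0 1).map fun z => ∑ i, z i ^ 2

instance (n : ℕ) : IsProbabilityMeasure (chiSq n) :=
  Measure.isProbabilityMeasure_map (by
    have h : Measurable fun z : Fin n → ℝ => ∑ i, z i ^ 2 := by fun_prop
    exact h.aemeasurable)

end IIDTest

end

/-! The quadratic form `v' (A ⊗ A)⁻¹ v` does not change under an invertible affine change of the
functions (`kronQuad_congr`, `covMat_affine`, `covVec_affine`). A diagonal change turns covariances
into correlations, so the two versions of each statistic are equal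
(`kronQuad_corr_eq_kronQuad_cov`). Whitening reduces the problem to functions `h` with mean zero and
identity covariance (`exists_isStandardized`).

For such `h` the products `h_i(X_t) h_j(X_{t+k})`, `1 ≤ k ≤ K`, are orthonormal in `L²`, over all
`t` as well (`integral_lagProd_mul`). Each depends on a window of `K + 1` observations, so sums over
blocks separated by gaps of length `K` are independent; the classical central limit theorem applies
to them, and long blocks make the gaps negligible (`tendsto_charFun_inv_sqrt_mul_sum`). Projecting
on all directions gives a standard Gaussian limit in dimension `m²K`.

Passing to the empirical covariances costs an error of order `N^(-1/2)` in mean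
(`tendstoInDistribution_covVec`). The empirical covariance matrix tends to the identity by the law
of large numbers, so by Slutsky the statistic tends to a sum of `m²K` squared independent normals
(`tendstoInDistribution_sum_kronQuad`). The Ljung–Box weights tend to one and change nothing. -/

noncomputable section
open scoped Topology

namespace IIDTest

/-! ### Central limit theorem for `K`-dependent orthogonal sequences -/

variable {Ω : Type*} [MeasurableSpace Ω] {P : Measure Ω}

lemma integral_sq_sum_of_orthogonal {ι : Type*} [DecidableEq ι] {Y : ι → Ω → ℝ} {v : ℝ}
    (hY2 : ∀ t, MemLp (Y t) 2 P)
    (horth : ∀ s t, ∫ ω, Y s ω * Y t ω ∂P = if s = t then v else 0) (S : Finset ι) :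
    ∫ ω, (∑ t ∈ S, Y t ω) ^ 2 ∂P = S.card * v := by
  have hi : ∀ s t, Integrable (fun ω => Y s ω * Y t ω) P := fun s t =>
    (hY2 s).integrable_mul (hY2 t)
  simp_rw [sq, Finset.sum_mul_sum]
  rw [integral_finsetSum _ fun s _ => integrable_finsetSum _ fun t _ => hi s t]
  simp_rw [integral_finsetSum _ fun t _ => hi _ t, horth]
  simp +contextual

variable [IsProbabilityMeasure P]

/-- Disjoint consecutive blocks of length `p` of an independent sequence are independent. -/
lemma iIndepFun_blocks {X : ℕ → Ω → ℝ} (hXm : ∀ i, Measurable (X i)) (hX : iIndepFun X P) (p : ℕ) :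
    iIndepFun (fun (j : ℕ) ω (s : Fin p) => X (j * p + s) ω) P := by
  have hinj : Function.Injective fun a : ℕ × Fin p => a.1 * p + (a.2 : ℕ) := by
    rintro ⟨j, s⟩ ⟨j', s'⟩ h
    have hp : 0 < p := s.pos
    simp only at h
    have hd := congrArg (· / p) h
    have hm := congrArg (· % p) h
    simp only [Nat.mod_eq_of_lt s.2, Nat.mod_eq_of_lt s'.2,
      Nat.add_comm (_ * p), Nat.add_mul_div_right _ _ hp, Nat.div_eq_of_lt s.2,
      Nat.div_eq_of_lt s'.2, Nat.add_mul_mod_self_right] at hd hm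
    ext <;> simp <;> omega
  have hpair : iIndepFun (fun (a : ℕ × Fin p) => X (a.1 * p + a.2)) P := hX.precomp hinj
  have hlaw := (iIndepFun_iff_map_fun_eq_infinitePi_map (fun a => hXm _)).1 hpair
  have : ∀ i, IsProbabilityMeasure (P.map (X i)) := fun i =>
    Measure.isProbabilityMeasure_map (hXm i).aemeasurable
  rw [iIndepFun_iff_map_fun_eq_infinitePi_map (fun j => by fun_prop)]
  have hrow : ∀ j : ℕ, P.map (fun ω (s : Fin p) => X (j * p + s) ω)
      = Measure.infinitePi fun s : Fin p => P.map (X (j * p + s)) := fun j =>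
    (iIndepFun_iff_map_fun_eq_infinitePi_map (fun a => hXm _)).1
      (hpair.precomp (g := fun s : Fin p => (j, s)) (fun _ _ h => by simpa using h))
  simp_rw [hrow]
  -- Independence means that the joint law is a product; currying the product over `ℕ × Fin p`
  -- exhibits it as a product of row laws.
  rw [← Measure.infinitePi_map_curry (fun (j : ℕ) (s : Fin p) => P.map (X (j * p + s))),
    ← hlaw, Measure.map_map (by fun_prop) (by fun_prop)]
  rfl

/-- The map `x ↦ exp(iux)` is `|u|`-Lipschitz and the `L¹` norm is at most the `L²` norm. This is
what allows a remainder small in `L²` to be dropped. -/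
lemma norm_charFun_map_sub_le {S B : Ω → ℝ} (hS : AEMeasurable S P) (hB : AEMeasurable B P)
    (hD : MemLp (fun ω => S ω - B ω) 2 P) (u : ℝ) :
    ‖charFun (P.map S) u - charFun (P.map B) u‖ ≤ |u| * √(∫ ω, (S ω - B ω) ^ 2 ∂P) := by
  have hint : ∀ {T : Ω → ℝ}, AEMeasurable T P →
      Integrable (fun ω => Complex.exp (u * T ω * Complex.I)) P := fun {T} hT => by
    refine (integrable_const (1 : ℝ)).mono' (by fun_prop) (ae_of_all _ fun ω => ?_)
    rw [← Complex.ofReal_mul, Complex.norm_exp_ofReal_mul_I]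
  have hchar : ∀ {T : Ω → ℝ}, AEMeasurable T P →
      charFun (P.map T) u = ∫ ω, Complex.exp (u * T ω * Complex.I) ∂P := fun {T} hT => by
    rw [charFun_apply_real, integral_map hT (by fun_prop)]
  rw [hchar hS, hchar hB, ← integral_sub (hint hS) (hint hB)]
  have hpt : ∀ ω, ‖Complex.exp (u * S ω * Complex.I) - Complex.exp (u * B ω * Complex.I)‖
      ≤ |u| * |S ω - B ω| := fun ω => by
    have h : Complex.exp (u * S ω * Complex.I) - Complex.exp (u * B ω * Complex.I)
        = Complex.exp ((u * B ω : ℝ) * Complex.I) *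
          (Complex.exp (Complex.I * (u * (S ω - B ω) : ℝ)) - 1) := by
      rw [mul_sub, ← Complex.exp_add]
      push_cast
      ring_nf
    rw [h, norm_mul, Complex.norm_exp_ofReal_mul_I, one_mul, ← abs_mul]
    exact Real.norm_exp_I_mul_ofReal_sub_one_le
  have hL1 : ∫ ω, |S ω - B ω| ∂P ≤ √(∫ ω, (S ω - B ω) ^ 2 ∂P) := by
    have hv := variance_nonneg (fun ω => |S ω - B ω|) P
    have hDa : MemLp (fun ω => |S ω - B ω|) 2 P := hD.abs
    rw [variance_eq_sub hDa] at hv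
    refine Real.le_sqrt_of_sq_le ?_
    simpa using hv
  calc _ ≤ ∫ ω, |u| * |S ω - B ω| ∂P := norm_integral_le_of_norm_le
        ((hD.integrable (by norm_num)).abs.const_mul _) (ae_of_all _ hpt)
    _ = |u| * ∫ ω, |S ω - B ω| ∂P := integral_const_mul _ _
    _ ≤ _ := by gcongr

/-- The block sums of length `q` separated by gaps of length `K` obey the central limit theorem. -/
lemma tendsto_charFun_blocks {X : ℕ → Ω → ℝ} (hXm : ∀ i, Measurable (X i))
    (hX : iIndepFun X P) (hXident : ∀ i, IdentDistrib (X i) (X 0) P P) {K : ℕ}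
    {G : (Fin (K + 1) → ℝ) → ℝ} (hG : Measurable G) {Y : ℕ → Ω → ℝ}
    (hY : ∀ t ω, Y t ω = G fun s => X (t + s) ω) (hY2 : ∀ t, MemLp (Y t) 2 P)
    (hmean : ∀ t, ∫ ω, Y t ω ∂P = 0) {v : ℝ}
    (horth : ∀ s t, ∫ ω, Y s ω * Y t ω ∂P = if s = t then v else 0)
    {q : ℕ} (hq : 0 < q) (u : ℝ) :
    Tendsto (fun N : ℕ => charFun (P.map fun ω => (√N)⁻¹ * ∑ j ∈ Finset.range (N / (q + K)),
        ∑ s ∈ Finset.range q, Y (j * (q + K) + s) ω) u) atTop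
      (𝓝 (Complex.exp (-((q : ℝ) / (q + K : ℕ) * v * u ^ 2 / 2 : ℝ)))) := by
  set p := q + K with hp
  have hp0 : 0 < p := by omega
  have hYm : ∀ t, Measurable (Y t) := fun t => by
    rw [show Y t = fun ω => G fun s => X (t + s) ω from funext (hY t)]
    fun_prop
  set B : ℕ → Ω → ℝ := fun j ω => ∑ s ∈ Finset.range q, Y (j * p + s) ω with hB
  -- The last window of a block starts at offset `q - 1` and ends at `q - 1 + K = p - 1`: a block
  -- sum uses only its own period of `p` observations.
  let Φ : (Fin p → ℝ) → ℝ := fun x => ∑ s : Fin q, G fun r : Fin (K + 1) => x ⟨s + r, by omega⟩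
  have hΦ : Measurable Φ := by fun_prop
  have hBΦ : ∀ j, B j = fun ω => Φ fun s => X (j * p + s) ω := fun j => by
    ext ω
    change ∑ s ∈ Finset.range q, Y (j * p + s) ω
      = ∑ s : Fin q, G fun r : Fin (K + 1) => X (j * p + (s + r)) ω
    rw [Finset.sum_range]
    exact Finset.sum_congr rfl fun s _ => by rw [hY]; simp only [add_assoc]
  have hBm : ∀ j, Measurable (B j) := fun j => by fun_prop
  have hBindep : iIndepFun B P := by
    rw [funext hBΦ]
    exact (iIndepFun_blocks hXm hX p).comp (fun _ => Φ) fun _ => hΦ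
  have hBident : ∀ j, IdentDistrib (B j) (B 0) P P := fun j => by
    rw [hBΦ, hBΦ]
    refine IdentDistrib.comp (u := Φ) (f := fun ω (s : Fin p) => X (j * p + s) ω)
      (g := fun ω (s : Fin p) => X (0 * p + s) ω) (IdentDistrib.pi
      (fun s : Fin p => (hXident _).trans (hXident _).symm)
      (hX.precomp fun a b h => ?_) (hX.precomp fun a b h => ?_)) hΦ <;>
    · ext
      simpa using h
  have hB2 : MemLp (B 0) 2 P := memLp_finsetSum _ fun s _ => hY2 _
  have hB0 : ∫ ω, B 0 ω ∂P = 0 := by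
    simp only [hB]
    rw [integral_finsetSum _ fun s _ => (hY2 _).integrable (by norm_num)]
    simp [hmean]
  have hvar : Var[B 0; P] = q * v := by
    rw [variance_of_integral_eq_zero (hBm 0).aemeasurable hB0]
    simp only [hB, zero_mul, zero_add]
    rw [integral_sq_sum_of_orthogonal hY2 horth, Finset.card_range]
  have hqv : 0 ≤ q * v := hvar ▸ variance_nonneg _ _
  have hclt := tendstoInDistribution_inv_sqrt_mul_sum_sub (Y := id)
    (P' := gaussianReal 0 Var[B 0; P].toNNReal) HasLaw.id hB2 hBindep hBident
  have hdiv : Tendsto (fun N : ℕ => N / p) atTop atTop := Nat.tendsto_div_const_atTop hp0.ne'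
  have hclt' : TendstoInDistribution
      (fun (N : ℕ) ω => (√(N / p : ℕ))⁻¹ * (∑ k ∈ Finset.range (N / p), B k ω
        - (N / p : ℕ) * ∫ ω, B 0 ω ∂P)) atTop id (fun _ => P)
      (gaussianReal 0 Var[B 0; P].toNNReal) :=
    ⟨fun N => hclt.forall_aemeasurable _, hclt.aemeasurable_limit, hclt.tendsto.comp hdiv⟩
  -- The classical theorem normalizes by the number of blocks, the claim by `N`; Slutsky absorbs the
  -- ratio.
  have hc : Tendsto (fun N : ℕ => √(N / p : ℕ) * (√N)⁻¹) atTop (𝓝 (√(1 / p))) := by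
    have h1 : Tendsto (fun N : ℕ => (⌊(N : ℝ) / p⌋₊ : ℝ) / N) atTop (𝓝 (1 / p)) := by
      have := (tendsto_nat_floor_mul_div_atTop (R := ℝ) (a := 1 / p) (by positivity)).comp
        tendsto_natCast_atTop_atTop
      refine this.congr fun N => ?_
      simp [div_eq_inv_mul]
    refine ((Real.continuous_sqrt.tendsto _).comp h1).congr fun N => ?_
    simp only [Function.comp_apply, Nat.floor_div_natCast, Nat.floor_natCast]
    rw [Real.sqrt_div (by positivity), div_eq_mul_inv]
  have hslutsky := hclt'.continuous_comp_prodMk_of_tendstoInMeasure_const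
    (g := fun z : ℝ × ℝ => z.1 * z.2) (by fun_prop) (Y := fun N _ => √(N / p : ℕ) * (√N)⁻¹)
    (c := √(1 / p)) (tendstoInMeasure_of_tendsto_ae (fun _ => by fun_prop)
      (ae_of_all _ fun _ => hc)) (fun _ => by fun_prop)
  have hlim := ProbabilityMeasure.tendsto_iff_tendsto_charFun.1 hslutsky.tendsto u
  simp only [ProbabilityMeasure.coe_mk, id] at hlim
  rw [gaussianReal_map_mul_const, charFun_gaussianReal] at hlim
  convert hlim.congr' ?_ using 2
  · have hcoe : ((NNReal.mk (√(1 / (p : ℝ)) ^ 2) (sq_nonneg _) * Var[B 0; P].toNNReal : NNReal) : ℝ)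
        = 1 / p * (q * v) := by
      rw [NNReal.coe_mul, NNReal.coe_mk, Real.sq_sqrt (by positivity), hvar,
        Real.coe_toNNReal _ hqv]
    rw [hcoe]
    push_cast
    congr 2
    ring
  · filter_upwards [eventually_ge_atTop p] with N hN
    have hNp : 0 < N / p := Nat.div_pos hN hp0
    congr 2
    ext ω
    rw [hB0]
    have : √(N / p : ℕ) ≠ 0 := by positivity
    field_simp
    simp [hB]

/-- Central limit theorem for a `K`-dependent orthogonal sequence of square integrable functions of
consecutive terms of an i.i.d. sequence. -/
theorem tendsto_charFun_inv_sqrt_mul_sum {X : ℕ → Ω → ℝ} (hXm : ∀ i, Measurable (X i))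
    (hX : iIndepFun X P) (hXident : ∀ i, IdentDistrib (X i) (X 0) P P) {K : ℕ}
    {G : (Fin (K + 1) → ℝ) → ℝ} (hG : Measurable G) {Y : ℕ → Ω → ℝ}
    (hY : ∀ t ω, Y t ω = G fun s => X (t + s) ω) (hY2 : ∀ t, MemLp (Y t) 2 P)
    (hmean : ∀ t, ∫ ω, Y t ω ∂P = 0) {v : ℝ}
    (horth : ∀ s t, ∫ ω, Y s ω * Y t ω ∂P = if s = t then v else 0) (u : ℝ) :
    Tendsto (fun N : ℕ => charFun (P.map fun ω => (√N)⁻¹ * ∑ t ∈ Finset.range N, Y t ω) u) atTop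
      (𝓝 (Complex.exp (-(v * u ^ 2 / 2 : ℝ)))) := by
  have hYm : ∀ t, AEMeasurable (Y t) P := fun t => (hY2 t).aestronglyMeasurable.aemeasurable
  have hv : 0 ≤ v := by
    have := horth 0 0
    rw [if_pos rfl] at this
    exact this ▸ integral_nonneg fun ω => mul_self_nonneg _
  set S : ℕ → Ω → ℝ := fun N ω => (√N)⁻¹ * ∑ t ∈ Finset.range N, Y t ω
  set Z : ℕ → ℕ → Ω → ℝ := fun q N ω => (√N)⁻¹ * ∑ j ∈ Finset.range (N / (q + K)),
        ∑ s ∈ Finset.range q, Y (j * (q + K) + s) ω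
  have hdiff : ∀ q N : ℕ, 0 < q → 0 < N → ‖charFun (P.map (S N)) u - charFun (P.map (Z q N)) u‖
      ≤ |u| * √(v * ((K : ℝ) / (q + K : ℕ) + (q + K : ℕ) / N)) := by
    intro q N hq hN
    set p := q + K with hp
    have hp0 : 0 < p := by omega
    set n := N / p with hn
    have hinj : Set.InjOn (fun a : ℕ × ℕ => a.1 * p + a.2)
        (Finset.range n ×ˢ Finset.range q : Finset (ℕ × ℕ)) := by
      rintro ⟨j, s⟩ h1 ⟨j', s'⟩ h2 h
      simp only [Finset.coe_product, Finset.coe_range, Set.mem_prod, Set.mem_Iio] at h1 h2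
      have hs : s < p := by omega
      have hs' : s' < p := by omega
      simp only at h
      have hd := congrArg (· / p) h
      have hm := congrArg (· % p) h
      simp only [Nat.mod_eq_of_lt hs, Nat.mod_eq_of_lt hs',
        Nat.add_comm (_ * p), Nat.add_mul_div_right _ _ hp0, Nat.div_eq_of_lt hs,
        Nat.div_eq_of_lt hs', Nat.add_mul_mod_self_right] at hd hm
      ext <;> simp <;> omega
    -- `good` collects the times kept by the blocks. By orthogonality the discarded part has second
    -- moment `v (N - nq) / N`, which the gap fraction `K / p` plus one incomplete period `p / N`
    -- bounds.
    set good := (Finset.range n ×ˢ Finset.range q).image fun a : ℕ × ℕ => a.1 * p + a.2 with hgood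
    have hsub : good ⊆ Finset.range N := by
      intro t ht
      simp only [hgood, Finset.mem_image, Finset.mem_product, Finset.mem_range, Prod.exists] at ht ⊢
      obtain ⟨j, s, ⟨hj, hs⟩, rfl⟩ := ht
      calc j * p + s < j * p + p := by omega
        _ = (j + 1) * p := by ring
        _ ≤ n * p := Nat.mul_le_mul_right _ hj
        _ ≤ N := Nat.div_mul_le_self _ _
    have hcard : good.card = n * q := by
      rw [hgood, Finset.card_image_of_injOn hinj, Finset.card_product]
      simp
    have hSZ : ∀ ω, S N ω - Z q N ω = (√N)⁻¹ * ∑ t ∈ Finset.range N \ good, Y t ω := fun ω => by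
      simp only [S, Z]
      rw [← mul_sub, ← Finset.sum_sdiff hsub, hgood, Finset.sum_image hinj, Finset.sum_product,
        add_sub_assoc, sub_self, add_zero]
    have hSm : AEMeasurable (S N) P := by fun_prop
    have hZm : AEMeasurable (Z q N) P := by fun_prop
    refine (norm_charFun_map_sub_le hSm hZm ?_ u).trans ?_
    · simp_rw [hSZ]
      exact (memLp_finsetSum _ fun t _ => hY2 t).const_mul _
    · gcongr
      simp_rw [hSZ, mul_pow]
      rw [integral_const_mul, integral_sq_sum_of_orthogonal hY2 horth, Finset.card_sdiff_of_subset
        hsub, Finset.card_range, hcard, inv_pow, Real.sq_sqrt (by positivity)]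
      have hle : n * q ≤ N := (Nat.mul_le_mul_left _ (by omega)).trans (Nat.div_mul_le_self N p)
      have hlt : N < n * p + p := by
        have := Nat.div_add_mod N p
        have := Nat.mod_lt N hp0
        nlinarith
      have hlt' : (N : ℝ) ≤ n * p + p := by exact_mod_cast hlt.le
      rw [Nat.cast_sub hle, ← mul_assoc, mul_comm v]
      gcongr
      have hpq : (p : ℝ) = q + K := by exact_mod_cast hp
      have hN' : (0 : ℝ) < N := by exact_mod_cast hN
      have hp' : (0 : ℝ) < p := by exact_mod_cast hp0
      have hnp : (n : ℝ) * p ≤ N := by exact_mod_cast Nat.div_mul_le_self N p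
      have hq' : (q : ℝ) ≤ p := by rw [hpq]; simp
      push_cast
      rw [← sub_nonneg]
      have : (K : ℝ) / p + p / N - (N : ℝ)⁻¹ * (N - n * q)
          = ((n * p + p - N) * q + p * (p - q)) / (p * N) := by
        rw [show (K : ℝ) = p - q by linarith]
        field_simp
        ring
      rw [this]
      have : 0 ≤ (n * p + p - N : ℝ) := by linarith
      have : 0 ≤ (p - q : ℝ) := by linarith
      positivity
  rw [Metric.tendsto_atTop]
  intro ε hε
  have hKq : Tendsto (fun q : ℕ => (K : ℝ) / (q + K : ℕ)) atTop (𝓝 0) :=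
    tendsto_const_nhds.div_atTop
      (tendsto_natCast_atTop_atTop.comp (tendsto_add_atTop_nat K))
  have h1 : ∀ᶠ q : ℕ in atTop, |u| * √(v * ((K : ℝ) / (q + K : ℕ) + 0)) < ε / 3 := by
    have : Tendsto (fun q : ℕ => |u| * √(v * ((K : ℝ) / (q + K : ℕ) + 0))) atTop
        (𝓝 (|u| * √(v * (0 + 0)))) := by
      refine Tendsto.const_mul _ ((Real.continuous_sqrt.tendsto _).comp ?_)
      exact (hKq.add_const 0).const_mul v
    refine this.eventually_lt_const ?_
    simp [hε]
  have h2 : ∀ᶠ q : ℕ in atTop, dist (Complex.exp (-((q : ℝ) / (q + K : ℕ) * v * u ^ 2 / 2 : ℝ)))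
      (Complex.exp (-(v * u ^ 2 / 2 : ℝ))) < ε / 3 := by
    have hq1 : Tendsto (fun q : ℕ => (q : ℝ) / (q + K : ℕ)) atTop (𝓝 1) := by
      have : Tendsto (fun q : ℕ => 1 - (K : ℝ) / (q + K : ℕ)) atTop (𝓝 (1 - 0)) := hKq.const_sub 1
      rw [sub_zero] at this
      refine this.congr' ?_
      filter_upwards [eventually_gt_atTop 0] with q hq
      have : (0 : ℝ) < (q : ℝ) + K := by positivity
      push_cast
      field_simp
      ring
    have hcont : Continuous fun x : ℝ => Complex.exp (-(x * v * u ^ 2 / 2 : ℝ)) := by fun_prop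
    have := (hcont.tendsto 1).comp hq1
    simp only [one_mul] at this
    exact (Metric.tendsto_nhds.1 this) _ (by positivity)
  -- The block length is fixed first, making the gaps negligible and the block limit close to the
  -- target; only then does `N` grow.
  obtain ⟨q, hq1, hq2, hq0⟩ := (h1.and (h2.and (eventually_gt_atTop 0))).exists
  have h3 : ∀ᶠ N : ℕ in atTop,
      |u| * √(v * ((K : ℝ) / (q + K : ℕ) + (q + K : ℕ) / N)) < ε / 3 := by
    have : Tendsto (fun N : ℕ => |u| * √(v * ((K : ℝ) / (q + K : ℕ) + (q + K : ℕ) / N))) atTop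
        (𝓝 (|u| * √(v * ((K : ℝ) / (q + K : ℕ) + 0)))) := by
      refine Tendsto.const_mul _ ((Real.continuous_sqrt.tendsto _).comp ?_)
      exact (tendsto_const_nhds.add (tendsto_const_div_atTop_nhds_zero_nat _)).const_mul v
    exact this.eventually_lt_const hq1
  have h4 := (Metric.tendsto_nhds.1
    (tendsto_charFun_blocks hXm hX hXident hG hY hY2 hmean horth hq0 u)) (ε / 3) (by positivity)
  rw [← eventually_atTop]
  filter_upwards [h3, h4, eventually_gt_atTop 0] with N h3 h4 hN
  have h5 := hdiff q N hq0 hN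
  rw [← dist_eq_norm] at h5
  linarith [dist_triangle4 (charFun (P.map (S N)) u) (charFun (P.map (Z q N)) u)
    (Complex.exp (-((q : ℝ) / (q + K : ℕ) * v * u ^ 2 / 2 : ℝ)))
    (Complex.exp (-(v * u ^ 2 / 2 : ℝ)))]

/-! ### Lagged products of a standardized family and their joint Gaussian limit -/

/-- An i.i.d. sequence `X` together with functions `h` such that the vector `h (X 0)` is centered,
has the identity as its covariance matrix, and has finite fourth moments. -/
structure IsStandardized {Ω : Type*} [MeasurableSpace Ω] (P : Measure Ω) (X : ℕ → Ω → ℝ)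
    {m : ℕ} (h : Fin m → ℝ → ℝ) : Prop where
  measurable_obs : ∀ t, Measurable (X t)
  indep : iIndepFun X P
  ident : ∀ t, IdentDistrib (X t) (X 0) P P
  measurable_fun : ∀ i, Measurable (h i)
  memLp : ∀ i, MemLp (fun ω => h i (X 0 ω)) 4 P
  mean : ∀ i, ∫ ω, h i (X 0 ω) ∂P = 0
  orth : ∀ i j, ∫ ω, h i (X 0 ω) * h j (X 0 ω) ∂P = if i = j then 1 else 0

/-- The lagged product `h_i(X_t) h_j(X_{t+k+1})`, where `a = (k, i, j)`. -/
def lagProd {Ω : Type*} (X : ℕ → Ω → ℝ) {m K : ℕ} (h : Fin m → ℝ → ℝ)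
    (t : ℕ) (a : Fin K × (Fin m × Fin m)) (ω : Ω) : ℝ :=
  h a.2.1 (X t ω) * h a.2.2 (X (t + (a.1 + 1)) ω)

namespace IsStandardized

variable {Ω : Type*} [MeasurableSpace Ω] {P : Measure Ω} [IsProbabilityMeasure P]
  {X : ℕ → Ω → ℝ} {m : ℕ} {h : Fin m → ℝ → ℝ}

omit [IsProbabilityMeasure P] in
lemma measurable_comp (H : IsStandardized P X h) (i : Fin m) (t : ℕ) :
    Measurable fun ω => h i (X t ω) :=
  (H.measurable_fun i).comp (H.measurable_obs t)

omit [IsProbabilityMeasure P] in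
lemma memLp_four (H : IsStandardized P X h) (i : Fin m) (t : ℕ) :
    MemLp (fun ω => h i (X t ω)) 4 P :=
  (((H.ident t).comp (H.measurable_fun i)).memLp_iff).2 (H.memLp i)

lemma memLp_two (H : IsStandardized P X h) (i : Fin m) (t : ℕ) :
    MemLp (fun ω => h i (X t ω)) 2 P :=
  (H.memLp_four i t).mono_exponent (by norm_num)

omit [IsProbabilityMeasure P] in
lemma integral_eq_zero (H : IsStandardized P X h) (i : Fin m) (t : ℕ) :
    ∫ ω, h i (X t ω) ∂P = 0 := by
  rw [← H.mean i]
  exact ((H.ident t).comp (H.measurable_fun i)).integral_eq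

omit [IsProbabilityMeasure P] in
lemma integral_mul_self (H : IsStandardized P X h) (i j : Fin m) (t : ℕ) :
    ∫ ω, h i (X t ω) * h j (X t ω) ∂P = if i = j then 1 else 0 := by
  rw [← H.orth i j]
  exact ((H.ident t).comp ((H.measurable_fun i).mul (H.measurable_fun j))).integral_eq

omit [IsProbabilityMeasure P] in
lemma integral_mul_of_ne (H : IsStandardized P X h) (i j : Fin m) {s t : ℕ} (hst : s ≠ t) :
    ∫ ω, h i (X s ω) * h j (X t ω) ∂P = 0 := by
  have := ((H.indep.indepFun hst).comp (H.measurable_fun i)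
    (H.measurable_fun j)).integral_fun_mul_eq_mul_integral
      (H.measurable_comp i s).aestronglyMeasurable (H.measurable_comp j t).aestronglyMeasurable
  simpa [Function.comp_def, H.integral_eq_zero] using this

omit [IsProbabilityMeasure P] in
lemma integral_mul_time (H : IsStandardized P X h) (i : Fin m) (s t : ℕ) :
    ∫ ω, h i (X s ω) * h i (X t ω) ∂P = if s = t then 1 else 0 := by
  split_ifs with hst
  · rw [hst, H.integral_mul_self, if_pos rfl]
  · exact H.integral_mul_of_ne i i hst

omit [IsProbabilityMeasure P] in
-- The factor at time `a` is centred and independent of the other three, whose times may coincide.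
-- This kills every mixed moment in which some time occurs exactly once.
lemma integral_mul_triple (H : IsStandardized P X h) (i j k l : Fin m) {a b c d : ℕ}
    (hb : a ≠ b) (hc : a ≠ c) (hd : a ≠ d) :
    ∫ ω, h i (X a ω) * (h j (X b ω) * h k (X c ω) * h l (X d ω)) ∂P = 0 := by
  have hdisj : Disjoint ({a} : Finset ℕ) {b, c, d} := by simp [hb, hc, hd]
  have hind := H.indep.indepFun_finset _ _ hdisj H.measurable_obs
  have hi := H.measurable_fun i
  have hj := H.measurable_fun j
  have hk := H.measurable_fun k
  have hl := H.measurable_fun l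
  have := hind.comp (φ := fun v : ({a} : Finset ℕ) → ℝ => h i (v ⟨a, by simp⟩))
    (ψ := fun v : ({b, c, d} : Finset ℕ) → ℝ => h j (v ⟨b, by simp⟩) * h k (v ⟨c, by simp⟩) * h l (v ⟨d, by simp⟩))
    (by fun_prop) (by fun_prop)
  have := this.integral_fun_mul_eq_mul_integral
    (H.measurable_comp i a).aestronglyMeasurable
    (((H.measurable_comp j b).mul (H.measurable_comp k c)).mul
      (H.measurable_comp l d)).aestronglyMeasurable
  simpa [Function.comp_def, H.integral_eq_zero] using this

variable {K : ℕ}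

omit [IsProbabilityMeasure P] in
lemma measurable_lagProd (H : IsStandardized P X h) (t : ℕ) (a : Fin K × (Fin m × Fin m)) :
    Measurable (lagProd X h t a) :=
  (H.measurable_comp _ _).mul (H.measurable_comp _ _)

omit [IsProbabilityMeasure P] in
lemma memLp_lagProd (H : IsStandardized P X h) (t : ℕ) (a : Fin K × (Fin m × Fin m)) :
    MemLp (lagProd X h t a) 2 P := by
  have : ENNReal.HolderTriple 4 4 2 := ⟨by
    rw [← ENNReal.toReal_eq_toReal_iff' (by simp) (by simp), ENNReal.toReal_add (by simp) (by simp)]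
    norm_num⟩
  exact (H.memLp_four a.2.2 (t + (a.1 + 1))).mul (H.memLp_four a.2.1 t)

omit [IsProbabilityMeasure P] in
lemma integral_lagProd (H : IsStandardized P X h) (t : ℕ) (a : Fin K × (Fin m × Fin m)) :
    ∫ ω, lagProd X h t a ω ∂P = 0 :=
  H.integral_mul_of_ne _ _ (by omega)

omit [IsProbabilityMeasure P] in
-- If `s ≠ t`, the smaller of the two occurs only once among the four times; if `s = t` and the lags
-- differ, the largest time does. For equal times and lags the integral splits into two covariances,
-- one at each time.
lemma integral_lagProd_mul (H : IsStandardized P X h) (s t : ℕ) (a b : Fin K × (Fin m × Fin m)) :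
    ∫ ω, lagProd X h s a ω * lagProd X h t b ω ∂P = if s = t ∧ a = b then 1 else 0 := by
  obtain ⟨k, i, j⟩ := a
  obtain ⟨l, i', j'⟩ := b
  simp only [lagProd]
  rcases lt_trichotomy s t with hst | rfl | hst
  · rw [if_neg (by omega), ← H.integral_mul_triple i j i' j' (a := s) (b := s + (k + 1)) (c := t)
      (d := t + (l + 1)) (by omega) (by omega) (by omega)]
    congr 1 with ω
    ring
  · rcases lt_trichotomy k l with hkl | rfl | hkl
    · rw [if_neg (by simp [hkl.ne]), ← H.integral_mul_triple j' j i i' (a := s + (l + 1))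
        (b := s + (k + 1)) (c := s) (d := s) (by simpa [Fin.ext_iff] using hkl.ne') (by omega)
        (by omega)]
      congr 1 with ω
      ring
    · have := ((H.indep.indepFun (show s ≠ s + (k + 1) by omega)).comp
        ((H.measurable_fun i).mul (H.measurable_fun i'))
        ((H.measurable_fun j).mul (H.measurable_fun j'))).integral_fun_mul_eq_mul_integral
        ((H.measurable_comp i s).mul (H.measurable_comp i' s)).aestronglyMeasurable
        ((H.measurable_comp j (s + (k + 1))).mul
          (H.measurable_comp j' (s + (k + 1)))).aestronglyMeasurable
      simp only [Function.comp_def, Pi.mul_apply, H.integral_mul_self] at this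
      calc _ = ∫ ω, h i (X s ω) * h i' (X s ω) *
            (h j (X (s + (k + 1)) ω) * h j' (X (s + (k + 1)) ω)) ∂P := by
            congr 1 with ω
            ring
        _ = _ := by
            rw [this]
            by_cases h1 : i = i' <;> by_cases h2 : j = j' <;> simp [h1, h2]
    · rw [if_neg (by simp [hkl.ne']), ← H.integral_mul_triple j j' i i' (a := s + (k + 1))
        (b := s + (l + 1)) (c := s) (d := s) (by simpa [Fin.ext_iff] using hkl.ne') (by omega)
        (by omega)]
      congr 1 with ω
      ring
  · rw [if_neg (by omega), ← H.integral_mul_triple i' j' i j (a := t) (b := t + (l + 1)) (c := s)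
      (d := s + (k + 1)) (by omega) (by omega) (by omega)]
    congr 1 with ω
    ring

omit [IsProbabilityMeasure P] in
lemma integral_lagProd_mul_time (H : IsStandardized P X h) (a : Fin K × (Fin m × Fin m))
    (s t : ℕ) :
    ∫ ω, lagProd X h s a ω * lagProd X h t a ω ∂P = if s = t then 1 else 0 := by
  simp [H.integral_lagProd_mul]

/-- The vector of normalized sums of lagged products is asymptotically standard Gaussian. -/
theorem tendstoInDistribution_lagProd (H : IsStandardized P X h) (K : ℕ) :
    TendstoInDistribution (fun (N : ℕ) ω => (WithLp.toLp 2 fun a : Fin K × (Fin m × Fin m) =>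
        (√N)⁻¹ * ∑ t ∈ Finset.range N, lagProd X h t a ω : EuclideanSpace ℝ _)) atTop id
      (fun _ => P) (stdGaussian (EuclideanSpace ℝ (Fin K × (Fin m × Fin m)))) := by
  have hL := fun t (a : Fin K × (Fin m × Fin m)) => H.measurable_lagProd t a
  have hmeas : ∀ N : ℕ, Measurable fun ω => (WithLp.toLp 2 fun a : Fin K × (Fin m × Fin m) =>
      (√N)⁻¹ * ∑ t ∈ Finset.range N, lagProd X h t a ω : EuclideanSpace ℝ _) := fun N => by
    fun_prop
  refine ⟨fun N => (hmeas N).aemeasurable, aemeasurable_id,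
    ProbabilityMeasure.tendsto_iff_tendsto_charFun.2 fun u => ?_⟩
  simp only [ProbabilityMeasure.coe_mk, Measure.map_id, charFun_stdGaussian]
  -- Cramér–Wold: the characteristic function at `u` is that of the scalar sum of `Y` at `1`, and
  -- orthonormality gives `Y` the variance `‖u‖²`.
  set Y : ℕ → Ω → ℝ := fun t ω => ∑ a, u a * lagProd X h t a ω with hYdef
  have hh := H.measurable_fun
  let G : (Fin (K + 1) → ℝ) → ℝ := fun x => ∑ a : Fin K × (Fin m × Fin m),
    u a * (h a.2.1 (x 0) * h a.2.2 (x ⟨a.1 + 1, by omega⟩))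
  have hi : ∀ s t (a b : Fin K × (Fin m × Fin m)),
      Integrable (fun ω => lagProd X h s a ω * lagProd X h t b ω) P := fun s t a b =>
    (H.memLp_lagProd s a).integrable_mul (H.memLp_lagProd t b)
  have key := tendsto_charFun_inv_sqrt_mul_sum (Y := Y) (K := K) (G := G) (v := ‖u‖ ^ 2)
    H.measurable_obs H.indep H.ident (by fun_prop) (fun t ω => rfl)
    (fun t => memLp_finsetSum _ fun a _ => (H.memLp_lagProd t a).const_mul _) ?_ ?_ 1
  · convert key using 2 with N
    · rw [charFun_apply_real, charFun_apply, integral_map (hmeas N).aemeasurable (by fun_prop),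
        integral_map (Measurable.aemeasurable (by fun_prop)) (by fun_prop)]
      congr 1 with ω
      simp only [PiLp.inner_apply, hYdef, Finset.mul_sum]
      rw [Finset.sum_comm]
      simp only [RCLike.inner_apply, conj_trivial, Finset.mul_sum]
      push_cast
      simp only [one_mul]
      congr 4 with a
      congr 1 with t
      ring
    · push_cast
      ring_nf
  · intro t
    simp only [hYdef]
    rw [integral_finsetSum _ fun a _ => ((H.memLp_lagProd t a).integrable (by norm_num)).const_mul _]
    simp [integral_const_mul, H.integral_lagProd]
  · intro s t
    have hexp : ∀ ω, Y s ω * Y t ω = ∑ a, ∑ b, u a * u b * (lagProd X h s a ω * lagProd X h t b ω) :=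
      fun ω => by
        simp only [hYdef, Finset.sum_mul_sum]
        refine Finset.sum_congr rfl fun a _ => Finset.sum_congr rfl fun b _ => ?_
        ring
    simp_rw [hexp]
    rw [integral_finsetSum _ fun a _ => integrable_finsetSum _ fun b _ => (hi s t a b).const_mul _]
    simp_rw [integral_finsetSum _ fun b _ => (hi s t _ b).const_mul _, integral_const_mul,
      H.integral_lagProd_mul]
    split_ifs with hst
    · rw [EuclideanSpace.norm_sq_eq]
      simp [hst, sq]
    · simp [hst]

end IsStandardized

/-! ### From sums of lagged products to empirical covariances -/

/-- Turns every error term into squares, whose expectations are known exactly. -/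
lemma abs_mul_le_half (a b : ℝ) : |a * b| ≤ (a ^ 2 + b ^ 2) / 2 := by
  rw [abs_mul, ← sq_abs a, ← sq_abs b]
  nlinarith [sq_nonneg (|a| - |b|)]

/-- The error made by replacing the empirical means by the true mean zero and `N - k` by `N` in a
lagged empirical covariance. -/
lemma abs_sqrt_mul_empCov_sub_le (f g : ℝ → ℝ) (x : ℕ → ℝ) {k N : ℕ} (hk : k < N) :
    |√N * empCov k f g x N - (√N)⁻¹ * ∑ t ∈ Finset.range N, f (x t) * g (x (t + k))| ≤
      k / (N - k : ℕ) * ((1 + (√N)⁻¹ ^ 2 * (∑ t ∈ Finset.range N, f (x t) * g (x (t + k))) ^ 2) / 2)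
      + √N / (N - k : ℕ) * ∑ t ∈ Finset.Ico (N - k) N, (1 + (f (x t) * g (x (t + k))) ^ 2) / 2
      + √N * ((1 / N : ℝ) ^ 2 * (∑ t ∈ Finset.range N, f (x t)) ^ 2
          + (1 / N : ℝ) ^ 2 * (∑ t ∈ Finset.range N, g (x t)) ^ 2
          + (1 / (N - k : ℕ) : ℝ) ^ 2 * (∑ t ∈ Finset.range (N - k), f (x t)) ^ 2 / 2
          + (1 / (N - k : ℕ) : ℝ) ^ 2 * (∑ t ∈ Finset.range (N - k), g (x (t + k))) ^ 2 / 2) := by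
  have hN : (0 : ℝ) < N := by exact_mod_cast (by omega : 0 < N)
  set n := N - k with hn
  have hn0 : (0 : ℝ) < n := by exact_mod_cast (by omega : 0 < n)
  have hnk : (N : ℝ) - k = n := by rw [hn, Nat.cast_sub hk.le]
  set W := ∑ t ∈ Finset.range N, f (x t) * g (x (t + k)) with hW
  set T := ∑ t ∈ Finset.Ico n N, f (x t) * g (x (t + k)) with hT
  set SA := ∑ t ∈ Finset.range n, f (x t)
  set SB := ∑ t ∈ Finset.range n, g (x (t + k))
  set F := empMean f x N with hF
  set Γ := empMean g x N with hΓ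
  have hsum : ∑ t ∈ Finset.range n, (f (x t) - F) * (g (x (t + k)) - Γ)
      = (W - T) - Γ * SA - F * SB + n * F * Γ := by
    have hWT : W - T = ∑ t ∈ Finset.range n, f (x t) * g (x (t + k)) := by
      rw [hW, hT, ← Finset.sum_range_add_sum_Ico _ (show n ≤ N by omega)]
      ring
    rw [hWT, Finset.mul_sum, Finset.mul_sum, ← Finset.sum_sub_distrib, ← Finset.sum_sub_distrib,
      show (n : ℝ) * F * Γ = ∑ t ∈ Finset.range n, F * Γ by simp; ring, ← Finset.sum_add_distrib]
    refine Finset.sum_congr rfl fun t _ => by ring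
  have hs : 0 < √(N : ℝ) := Real.sqrt_pos.2 hN
  have hss : √(N : ℝ) * √N = N := Real.mul_self_sqrt hN.le
  -- The three errors: the normalization, since `√N / n - 1 / √N = k / (n √N)`; the last `k`
  -- products, which reach beyond the sample; and the centring at empirical means.
  have hdecomp : √N * empCov k f g x N - (√N)⁻¹ * W
      = k / n * ((√N)⁻¹ * W) - √N / n * T
        + √N * (F * Γ - Γ * (1 / n * SA) - F * (1 / n * SB)) := by
    rw [empCov, hnk, hsum]
    have hinv : (√N)⁻¹ * W = √N * W / N := by
      rw [eq_div_iff hN.ne', inv_mul_eq_div, div_mul_eq_mul_div, div_eq_iff hs.ne', mul_right_comm,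
        hss, mul_comm]
    rw [hinv, show (k : ℝ) = N - n by linarith]
    field_simp
    ring
  have h1 : |k / n * ((√N)⁻¹ * W)| ≤ k / n * ((1 + (√N)⁻¹ ^ 2 * W ^ 2) / 2) := by
    rw [abs_mul, abs_of_nonneg (a := (k / n : ℝ)) (by positivity)]
    gcongr
    simpa [mul_pow] using abs_mul_le_half 1 ((√N)⁻¹ * W)
  have h2 : |√N / n * T| ≤ √N / n * ∑ t ∈ Finset.Ico n N, (1 + (f (x t) * g (x (t + k))) ^ 2) / 2 := by
    rw [abs_mul, abs_of_nonneg (a := (√N / n : ℝ)) (by positivity)]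
    gcongr
    refine (Finset.abs_sum_le_sum_abs _ _).trans (Finset.sum_le_sum fun t _ => ?_)
    simpa using abs_mul_le_half 1 (f (x t) * g (x (t + k)))
  have hF2 : F ^ 2 = (1 / N : ℝ) ^ 2 * (∑ t ∈ Finset.range N, f (x t)) ^ 2 := by
    rw [hF, empMean, mul_pow]
  have hG2 : Γ ^ 2 = (1 / N : ℝ) ^ 2 * (∑ t ∈ Finset.range N, g (x t)) ^ 2 := by
    rw [hΓ, empMean, mul_pow]
  have h3 : |√N * (F * Γ - Γ * (1 / n * SA) - F * (1 / n * SB))|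
      ≤ √N * (F ^ 2 + Γ ^ 2 + (1 / n) ^ 2 * SA ^ 2 / 2 + (1 / n) ^ 2 * SB ^ 2 / 2) := by
    rw [abs_mul, abs_of_pos hs]
    gcongr
    have e1 := abs_le.1 (abs_mul_le_half F Γ)
    have e2 := abs_le.1 (abs_mul_le_half Γ (1 / n * SA))
    have e3 := abs_le.1 (abs_mul_le_half F (1 / n * SB))
    rw [mul_pow] at e2 e3
    rw [abs_le]
    constructor <;> linarith
  rw [hdecomp, ← hF2, ← hG2]
  exact (abs_add_le _ _).trans (add_le_add ((abs_sub _ _).trans (add_le_add h1 h2)) h3)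

lemma norm_le_sum_abs {ι : Type*} [Fintype ι] (x : EuclideanSpace ℝ ι) : ‖x‖ ≤ ∑ i, |x i| := by
  rw [EuclideanSpace.norm_eq]
  refine Real.sqrt_le_iff.2 ⟨Finset.sum_nonneg fun _ _ => abs_nonneg _, ?_⟩
  exact Finset.sum_sq_le_sq_sum_of_nonneg fun i _ => abs_nonneg (x i)

/-- `f` is integrable with integral `c`. -/
def IntegralEq {Ω : Type*} [MeasurableSpace Ω] (P : Measure Ω) (f : Ω → ℝ) (c : ℝ) : Prop :=
  Integrable f P ∧ ∫ ω, f ω ∂P = c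

namespace IntegralEq

variable {Ω : Type*} [MeasurableSpace Ω] {P : Measure Ω} {f g : Ω → ℝ} {a b : ℝ}

lemma add (hf : IntegralEq P f a) (hg : IntegralEq P g b) :
    IntegralEq P (fun ω => f ω + g ω) (a + b) :=
  ⟨hf.1.add hg.1, by rw [integral_add hf.1 hg.1, hf.2, hg.2]⟩

lemma const_mul (hf : IntegralEq P f a) (c : ℝ) : IntegralEq P (fun ω => c * f ω) (c * a) :=
  ⟨hf.1.const_mul c, by rw [integral_const_mul, hf.2]⟩

lemma div_const (hf : IntegralEq P f a) (c : ℝ) : IntegralEq P (fun ω => f ω / c) (a / c) :=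
  ⟨hf.1.div_const c, by rw [integral_div, hf.2]⟩

lemma sum {ι : Type*} {f : ι → Ω → ℝ} {a : ι → ℝ} (s : Finset ι)
    (hf : ∀ i, IntegralEq P (f i) (a i)) :
    IntegralEq P (fun ω => ∑ i ∈ s, f i ω) (∑ i ∈ s, a i) :=
  ⟨integrable_finsetSum _ fun i _ => (hf i).1, by
    rw [integral_finsetSum _ fun i _ => (hf i).1]
    simp_rw [(hf _).2]⟩

end IntegralEq

/-- Markov's inequality applied to the dominating `G`; no measurability of `D` is needed. -/
lemma tendstoInMeasure_zero_of_norm_le {Ω E : Type*} [MeasurableSpace Ω] {P : Measure Ω}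
    [IsProbabilityMeasure P] [SeminormedAddCommGroup E] {D : ℕ → Ω → E} {G : ℕ → Ω → ℝ}
    (hG : ∀ᶠ N in atTop, Integrable (G N) P) (hle : ∀ᶠ N in atTop, ∀ ω, ‖D N ω‖ ≤ G N ω)
    (hint : Tendsto (fun N => ∫ ω, G N ω ∂P) atTop (𝓝 0)) : TendstoInMeasure P D atTop 0 := by
  rw [tendstoInMeasure_iff_measureReal_norm]
  intro ε hε
  have hlim : Tendsto (fun N => ε⁻¹ * ∫ ω, G N ω ∂P) atTop (𝓝 0) := by
    simpa using hint.const_mul ε⁻¹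
  refine squeeze_zero' (.of_forall fun _ => measureReal_nonneg) ?_ hlim
  filter_upwards [hG, hle] with N hGN hleN
  rw [inv_mul_eq_div, le_div_iff₀ hε, mul_comm]
  refine le_trans ?_ (mul_meas_ge_le_integral_of_nonneg
    (ae_of_all _ fun ω => (norm_nonneg _).trans (hleN ω)) hGN ε)
  refine mul_le_mul_of_nonneg_left (measureReal_mono (fun ω hω => ?_) (measure_ne_top _ _)) hε.le
  simp only [Set.mem_ofPred_eq, Pi.zero_apply, sub_zero] at hω ⊢
  exact hω.trans (hleN ω)

namespace IsStandardized

variable {Ω : Type*} [MeasurableSpace Ω] {P : Measure Ω} [IsProbabilityMeasure P]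
  {X : ℕ → Ω → ℝ} {m : ℕ} {h : Fin m → ℝ → ℝ}

omit [IsProbabilityMeasure P] in
lemma measurable_empMean (H : IsStandardized P X h) (i : Fin m) (N : ℕ) :
    Measurable fun ω => empMean (h i) (fun t => X t ω) N :=
  (Finset.measurable_sum _ fun t _ => H.measurable_comp i t).const_mul _

omit [IsProbabilityMeasure P] in
lemma measurable_empCov (H : IsStandardized P X h) (i j : Fin m) (N k : ℕ) :
    Measurable fun ω => empCov k (h i) (h j) (fun t => X t ω) N :=
  (Finset.measurable_sum _ fun t _ => ((H.measurable_comp i t).sub (H.measurable_empMean i N)).mul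
    ((H.measurable_comp j (t + k)).sub (H.measurable_empMean j N))).const_mul _

/-- The normalized empirical covariances are asymptotically standard Gaussian. -/
theorem tendstoInDistribution_covVec (H : IsStandardized P X h) (K : ℕ) :
    TendstoInDistribution (fun (N : ℕ) ω => (WithLp.toLp 2 fun a : Fin K × (Fin m × Fin m) =>
        √N * covVec h (fun t => X t ω) N (a.1 + 1) a.2 : EuclideanSpace ℝ _)) atTop id
      (fun _ => P) (stdGaussian (EuclideanSpace ℝ (Fin K × (Fin m × Fin m)))) := by
  refine tendstoInDistribution_of_tendstoInMeasure_sub _ _ (H.tendstoInDistribution_lagProd K) ?_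
    fun N => ?_
  swap
  · have := fun a : Fin K × (Fin m × Fin m) => H.measurable_empCov a.2.1 a.2.2 N (a.1 + 1)
    simp only [covVec]
    exact Measurable.aemeasurable (by fun_prop)
  let G : ℕ → (Fin K × (Fin m × Fin m)) → Ω → ℝ := fun N a ω =>
      (a.1 + 1 : ℕ) / (N - (a.1 + 1) : ℕ) *
        ((1 + (√N)⁻¹ ^ 2 * (∑ t ∈ Finset.range N, lagProd X h t a ω) ^ 2) / 2)
      + √N / (N - (a.1 + 1) : ℕ) *
        ∑ t ∈ Finset.Ico (N - (a.1 + 1)) N, (1 + lagProd X h t a ω ^ 2) / 2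
      + √N * ((1 / N : ℝ) ^ 2 * (∑ t ∈ Finset.range N, h a.2.1 (X t ω)) ^ 2
          + (1 / N : ℝ) ^ 2 * (∑ t ∈ Finset.range N, h a.2.2 (X t ω)) ^ 2
          + (1 / (N - (a.1 + 1) : ℕ) : ℝ) ^ 2 *
            (∑ t ∈ Finset.range (N - (a.1 + 1)), h a.2.1 (X t ω)) ^ 2 / 2
          + (1 / (N - (a.1 + 1) : ℕ) : ℝ) ^ 2 *
            (∑ t ∈ Finset.range (N - (a.1 + 1)), h a.2.2 (X (t + (a.1 + 1)) ω)) ^ 2 / 2)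
  have hLsq : ∀ (S : Finset ℕ) (a : Fin K × (Fin m × Fin m)),
      Integrable (fun ω => (∑ t ∈ S, lagProd X h t a ω) ^ 2) P := fun S a =>
    (memLp_finsetSum _ fun t _ => H.memLp_lagProd t a).integrable_sq
  have hL1 : ∀ (t : ℕ) (a : Fin K × (Fin m × Fin m)),
      Integrable (fun ω => lagProd X h t a ω ^ 2) P := fun t a => (H.memLp_lagProd t a).integrable_sq
  have hmsq : ∀ (S : Finset ℕ) (k : ℕ) (i : Fin m),
      Integrable (fun ω => (∑ t ∈ S, h i (X (t + k) ω)) ^ 2) P := fun S k i =>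
    (memLp_finsetSum _ fun t _ => H.memLp_two i (t + k)).integrable_sq
  have hmsq0 : ∀ (S : Finset ℕ) (i : Fin m),
      Integrable (fun ω => (∑ t ∈ S, h i (X t ω)) ^ 2) P := fun S i => hmsq S 0 i
  have hLint : ∀ (S : Finset ℕ) (a : Fin K × (Fin m × Fin m)),
      ∫ ω, (∑ t ∈ S, lagProd X h t a ω) ^ 2 ∂P = S.card := fun S a => by
    rw [integral_sq_sum_of_orthogonal (fun t => H.memLp_lagProd t a)
      (H.integral_lagProd_mul_time a), mul_one]
  have hL1int : ∀ (t : ℕ) (a : Fin K × (Fin m × Fin m)), ∫ ω, lagProd X h t a ω ^ 2 ∂P = 1 :=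
    fun t a => by simpa using hLint {t} a
  have hmint : ∀ (S : Finset ℕ) (k : ℕ) (i : Fin m),
      ∫ ω, (∑ t ∈ S, h i (X (t + k) ω)) ^ 2 ∂P = S.card := fun S k i => by
    rw [integral_sq_sum_of_orthogonal (v := 1) (Y := fun t ω => h i (X (t + k) ω))
      (fun t => H.memLp_two i (t + k)) (fun s t => by simp [H.integral_mul_time]), mul_one]
  have hmint0 : ∀ (S : Finset ℕ) (i : Fin m),
      ∫ ω, (∑ t ∈ S, h i (X t ω)) ^ 2 ∂P = S.card := fun S i => hmint S 0 i
  -- By orthonormality each squared sum of `n` terms contributes exactly `n`; the total is of order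
  -- `N^(-1/2)`.
  have hGval : ∀ (N : ℕ) a, IntegralEq P (G N a)
      ((a.1 + 1 : ℕ) / (N - (a.1 + 1) : ℕ) * ((1 + (√N)⁻¹ ^ 2 * N) / 2)
      + √N / (N - (a.1 + 1) : ℕ) * ((N - (N - (a.1 + 1)) : ℕ) * ((1 + 1) / 2))
      + √N * ((1 / N : ℝ) ^ 2 * N + (1 / N : ℝ) ^ 2 * N
          + (1 / (N - (a.1 + 1) : ℕ) : ℝ) ^ 2 * (N - (a.1 + 1) : ℕ) / 2
          + (1 / (N - (a.1 + 1) : ℕ) : ℝ) ^ 2 * (N - (a.1 + 1) : ℕ) / 2)) := fun N a => by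
    have hone : IntegralEq P (fun _ => 1) 1 := ⟨integrable_const _, by simp⟩
    have hLr : IntegralEq P (fun ω => (∑ t ∈ Finset.range N, lagProd X h t a ω) ^ 2) N :=
      ⟨hLsq _ _, by simp [hLint]⟩
    have hm : ∀ (n k : ℕ) i, IntegralEq P
        (fun ω => (∑ t ∈ Finset.range n, h i (X (t + k) ω)) ^ 2) n := fun n k i =>
      ⟨hmsq _ _ _, by simp [hmint]⟩
    have hm0 : ∀ (n : ℕ) i, IntegralEq P
        (fun ω => (∑ t ∈ Finset.range n, h i (X t ω)) ^ 2) n := fun n i => hm n 0 i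
    have htail : IntegralEq P (fun ω => ∑ t ∈ Finset.Ico (N - (a.1 + 1)) N,
        (1 + lagProd X h t a ω ^ 2) / 2) ((N - (N - (a.1 + 1)) : ℕ) * ((1 + 1) / 2)) := by
      have := IntegralEq.sum (Finset.Ico (N - (a.1 + 1)) N)
        (fun t => (hone.add (⟨hL1 t a, hL1int t a⟩ : IntegralEq P _ 1)).div_const 2)
      rwa [Finset.sum_const, Nat.card_Ico, nsmul_eq_mul] at this
    exact (((hone.add (hLr.const_mul _)).div_const 2).const_mul _ |>.add (htail.const_mul _)).add
      ((((((hm0 _ _).const_mul _).add ((hm0 _ _).const_mul _)).add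
        (((hm0 _ _).const_mul _).div_const 2)).add (((hm _ _ _).const_mul _).div_const 2)).const_mul _)
  have hGi : ∀ N a, Integrable (G N a) P := fun N a => (hGval N a).1
  have hGint : ∀ a, ∀ᶠ N : ℕ in atTop, ∫ ω, G N a ω ∂P
      = (a.1 + 1 : ℕ) / (N - (a.1 + 1) : ℕ) + √N / (N - (a.1 + 1) : ℕ) * (a.1 + 1 : ℕ)
        + √N * (2 / N + 1 / (N - (a.1 + 1) : ℕ)) := by
    intro a
    filter_upwards [eventually_gt_atTop (a.1 + 1 : ℕ)] with N hN
    have hN0 : (0 : ℝ) < N := by exact_mod_cast (by omega : 0 < N)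
    have hn0 : (0 : ℝ) < (N - (a.1 + 1) : ℕ) := by
      exact_mod_cast (by omega : 0 < N - (a.1 + 1 : ℕ))
    rw [(hGval N a).2, show N - (N - (a.1 + 1 : ℕ)) = a.1 + 1 by omega, inv_pow,
      Real.sq_sqrt hN0.le]
    field_simp
    ring
  have hlim : ∀ a, Tendsto (fun N => ∫ ω, G N a ω ∂P) atTop (𝓝 0) := by
    intro a
    refine Tendsto.congr' (EventuallyEq.symm (hGint a)) ?_
    set k : ℕ := a.1 + 1
    have hinv : Tendsto (fun N : ℕ => (1 : ℝ) / (N - k : ℕ)) atTop (𝓝 0) :=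
      tendsto_const_nhds.div_atTop (tendsto_natCast_atTop_atTop.comp (tendsto_sub_atTop_nat k))
    have hsq : Tendsto (fun N : ℕ => √N / N) atTop (𝓝 0) := by
      simp_rw [Real.sqrt_div_self']
      exact tendsto_const_nhds.div_atTop
        (Real.tendsto_sqrt_atTop.comp tendsto_natCast_atTop_atTop)
    have hsqn : Tendsto (fun N : ℕ => √N / (N - k : ℕ)) atTop (𝓝 0) := by
      have hb : Tendsto (fun N : ℕ => √N / N * (1 + k * (1 / (N - k : ℕ)))) atTop
          (𝓝 (0 * (1 + k * 0))) := hsq.mul ((hinv.const_mul _).const_add _)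
      rw [zero_mul] at hb
      refine hb.congr' ?_
      filter_upwards [eventually_gt_atTop k] with N hN
      have hN0 : (0 : ℝ) < N := by exact_mod_cast (by omega : 0 < N)
      have hn0 : (0 : ℝ) < (N - k : ℕ) := by exact_mod_cast (by omega : 0 < N - k)
      have : (N : ℝ) = (N - k : ℕ) + k := by
        rw [Nat.cast_sub hN.le]
        ring
      field_simp
      rw [← this]
    have : Tendsto (fun N : ℕ => k * (1 / (N - k : ℕ)) + √N / (N - k : ℕ) * k
        + (2 * (√N / N) + √N / (N - k : ℕ))) atTop (𝓝 (k * 0 + 0 * k + (2 * 0 + 0))) :=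
      ((hinv.const_mul _).add (hsqn.mul_const _)).add ((hsq.const_mul _).add hsqn)
    simp only [mul_zero, zero_mul, add_zero] at this
    refine this.congr fun N => ?_
    ring
  refine tendstoInMeasure_zero_of_norm_le (G := fun N ω => ∑ a, G N a ω)
    (.of_forall fun N => integrable_finsetSum _ fun a _ => hGi N a) ?_ ?_
  · filter_upwards [eventually_gt_atTop K] with N hN ω
    refine (norm_le_sum_abs _).trans (Finset.sum_le_sum fun a _ => ?_)
    exact abs_sqrt_mul_empCov_sub_le (h a.2.1) (h a.2.2) (fun t => X t ω)
      (show (a.1 + 1 : ℕ) < N by omega)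
  · simp_rw [integral_finsetSum _ fun a _ => hGi _ a]
    simpa using tendsto_finsetSum Finset.univ fun a _ => hlim a

end IsStandardized

/-! ### Chi-squared limit of the quadratic forms in the standardized case -/

lemma stdGaussian_map_sum_sq {ι : Type*} [Fintype ι] {n : ℕ} (hn : Fintype.card ι = n) :
    (stdGaussian (EuclideanSpace ℝ ι)).map (fun z => ∑ a, z a ^ 2) = chiSq n := by
  obtain ⟨e⟩ : Nonempty (Fin n ≃ ι) := ⟨(Fintype.equivFinOfCardEq hn).symm⟩
  have hpres := measurePreserving_piCongrLeft (α := fun _ : ι => ℝ) (fun _ => gaussianReal 0 1) e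
  rw [← map_pi_eq_stdGaussian, Measure.map_map (by fun_prop) (by fun_prop), ← hpres.map_eq,
    Measure.map_map (by fun_prop) (by fun_prop), chiSq]
  congr 1
  ext z
  simp only [Function.comp_apply]
  rw [← e.sum_comp]
  refine Finset.sum_congr rfl fun i _ => ?_
  rw [MeasurableEquiv.coe_piCongrLeft, Equiv.piCongrLeft_apply_apply (fun _ : ι => ℝ) e z i]

/-- Convergence in distribution only depends on the law of the limit. -/
lemma tendstoInDistribution_id_of_map_eq {Ω Ω' E : Type*} [MeasurableSpace Ω] {P : Measure Ω}
    [IsProbabilityMeasure P] [MeasurableSpace Ω'] {μ : Measure Ω'} [IsProbabilityMeasure μ]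
    [MeasurableSpace E] [TopologicalSpace E] [OpensMeasurableSpace E]
    {ν : Measure E} [IsProbabilityMeasure ν]
    {Y : ℕ → Ω → E} {Z : Ω' → E} (hY : TendstoInDistribution Y atTop Z (fun _ => P) μ)
    (hν : μ.map Z = ν) : TendstoInDistribution Y atTop id (fun _ => P) ν := by
  refine ⟨hY.forall_aemeasurable, aemeasurable_id, ?_⟩
  convert hY.tendsto using 2
  simp [hν]

/-- Splitting `N` as `√N * √N` displays the statistic as a continuous function of the rescaled
covariances and the weighted inverse matrix, as Slutsky requires. -/
lemma mul_sum_kronQuad {m : ℕ} (K N : ℕ) (w : ℕ → ℝ) (A : Matrix (Fin m) (Fin m) ℝ)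
    (v : ℕ → Fin m × Fin m → ℝ) :
    N * ∑ k ∈ Finset.Icc 1 K, w k * kronQuad A (v k) = ∑ k : Fin K, ∑ p, ∑ q,
      √N * v (k + 1) p * (w (k + 1) * (A ⊗ₖ A)⁻¹ p q * (√N * v (k + 1) q)) := by
  have hIcc : Finset.Icc 1 K = (Finset.range K).image (· + 1) := by
    ext k
    simp only [Finset.mem_Icc, Finset.mem_image, Finset.mem_range]
    exact ⟨fun hk => ⟨k - 1, by omega, by omega⟩, by rintro ⟨j, hj, rfl⟩; omega⟩
  rw [hIcc, Finset.sum_image (fun a _ b _ hab => by simpa using hab), Finset.sum_range,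
    Finset.mul_sum]
  refine Finset.sum_congr rfl fun k _ => ?_
  simp only [kronQuad, dotProduct, Matrix.mulVec, Finset.mul_sum]
  refine Finset.sum_congr rfl fun p _ => Finset.sum_congr rfl fun q _ => ?_
  have hs : √(N : ℝ) * √N = N := Real.mul_self_sqrt (Nat.cast_nonneg N)
  calc _ = N * (w (k + 1) * (v (k + 1) p * ((A ⊗ₖ A)⁻¹ p q * v (k + 1) q))) := by ring
    _ = √N * √N * (w (k + 1) * (v (k + 1) p * ((A ⊗ₖ A)⁻¹ p q * v (k + 1) q))) := by rw [hs]
    _ = _ := by ring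

namespace IsStandardized

variable {Ω : Type*} [MeasurableSpace Ω] {P : Measure Ω} [IsProbabilityMeasure P]
  {X : ℕ → Ω → ℝ} {m : ℕ} {h : Fin m → ℝ → ℝ}

omit [IsProbabilityMeasure P] in
lemma ae_tendsto_mean (H : IsStandardized P X h) {g : ℝ → ℝ} (hg : Measurable g)
    (hint : Integrable (fun ω => g (X 0 ω)) P) :
    ∀ᵐ ω ∂P, Tendsto (fun N : ℕ => (∑ t ∈ Finset.range N, g (X t ω)) / N) atTop
      (𝓝 (∫ ω, g (X 0 ω) ∂P)) :=
  strong_law_ae_real (fun t ω => g (X t ω)) hint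
    (fun _ _ hst => (H.indep.indepFun hst).comp hg hg) fun t => (H.ident t).comp hg

/-- The empirical covariance matrix converges almost surely to the identity. -/
lemma ae_tendsto_covMat (H : IsStandardized P X h) :
    ∀ᵐ ω ∂P, Tendsto (fun N => covMat h (fun t => X t ω) N) atTop (𝓝 1) := by
  have hmean : ∀ᵐ ω ∂P, ∀ i, Tendsto (fun N : ℕ => (∑ t ∈ Finset.range N, h i (X t ω)) / N) atTop
      (𝓝 0) := by
    refine ae_all_iff.2 fun i => ?_
    simpa [H.mean] using H.ae_tendsto_mean (H.measurable_fun i)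
      ((H.memLp_two i 0).integrable (by norm_num))
  have hprod : ∀ᵐ ω ∂P, ∀ i j, Tendsto (fun N : ℕ =>
      (∑ t ∈ Finset.range N, h i (X t ω) * h j (X t ω)) / N) atTop (𝓝 (if i = j then 1 else 0)) := by
    refine ae_all_iff.2 fun i => ae_all_iff.2 fun j => ?_
    simpa [H.orth] using H.ae_tendsto_mean (g := fun x => h i x * h j x)
      ((H.measurable_fun i).mul (H.measurable_fun j))
      ((H.memLp_two i 0).integrable_mul (H.memLp_two j 0))
  filter_upwards [hmean, hprod] with ω hmean hprod
  refine tendsto_pi_nhds.2 fun i => tendsto_pi_nhds.2 fun j => ?_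
  have hlim := (hprod i j).sub ((hmean i).mul (hmean j))
  rw [mul_zero, sub_zero, ← Matrix.one_apply] at hlim
  refine hlim.congr' ?_
  filter_upwards [eventually_gt_atTop 0] with N hN
  have hN0 : (N : ℝ) ≠ 0 := by positivity
  simp only [covMat, Matrix.of_apply, empCov, Nat.cast_zero, sub_zero, Nat.sub_zero, add_zero]
  simp only [sub_mul, mul_sub, Finset.sum_sub_distrib, ← Finset.sum_mul, ← Finset.mul_sum,
    Finset.sum_const, Finset.card_range, nsmul_eq_mul, empMean]
  field_simp
  ring

lemma tendsto_kronecker_inv {A : ℕ → Matrix (Fin m) (Fin m) ℝ} (hA : Tendsto A atTop (𝓝 1))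
    (p q : Fin m × Fin m) :
    Tendsto (fun N => (A N ⊗ₖ A N)⁻¹ p q) atTop (𝓝 (if p = q then 1 else 0)) := by
  have hinv : Tendsto (fun N => (A N)⁻¹) atTop (𝓝 1) := by
    have hc : ContinuousAt Ring.inverse (1 : Matrix (Fin m) (Fin m) ℝ).det := by
      rw [Matrix.det_one]
      exact NormedRing.inverse_continuousAt (1 : ℝˣ)
    have := (continuousAt_matrix_inv (1 : Matrix (Fin m) (Fin m) ℝ) hc).tendsto.comp hA
    simpa [Function.comp_def] using this
  have hent : ∀ i j, Tendsto (fun N => (A N)⁻¹ i j) atTop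
      (𝓝 ((1 : Matrix (Fin m) (Fin m) ℝ) i j)) := fun i j =>
    tendsto_pi_nhds.1 (tendsto_pi_nhds.1 hinv i) j
  simp_rw [Matrix.inv_kronecker, Matrix.kroneckerMap_apply]
  convert (hent p.1 q.1).mul (hent p.2 q.2) using 2
  rw [← Matrix.one_apply, ← Matrix.one_kronecker_one, Matrix.kroneckerMap_apply]

/-- The formula adjugate over determinant, with `0⁻¹ = 0`, is also valid at singular matrices, so no
exceptional set has to be removed. -/
lemma measurable_kronecker_inv {α : Type*} [MeasurableSpace α] {A : α → Matrix (Fin m) (Fin m) ℝ}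
    (hA : ∀ i j, Measurable fun x => A x i j) (p q : Fin m × Fin m) :
    Measurable fun x => (A x ⊗ₖ A x)⁻¹ p q := by
  have hA' : Measurable fun x => (fun i j => A x i j : Fin m → Fin m → ℝ) :=
    measurable_pi_lambda _ fun i => measurable_pi_lambda _ fun j => hA i j
  have hdetc : Continuous fun B : Fin m → Fin m → ℝ => (Matrix.of B).det :=
    Continuous.matrix_det continuous_id
  have hadjc : ∀ i j, Continuous fun B : Fin m → Fin m → ℝ => (Matrix.of B).adjugate i j :=
    fun i j => (Continuous.matrix_adjugate continuous_id).matrix_elem i j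
  have hdet : Measurable fun x => (A x).det := hdetc.measurable.comp hA'
  have hadj : ∀ i j, Measurable fun x => (A x).adjugate i j := fun i j =>
    (hadjc i j).measurable.comp hA'
  simp_rw [Matrix.inv_kronecker, Matrix.kroneckerMap_apply, Matrix.inv_def, Matrix.smul_apply,
    Ring.inverse_eq_inv', smul_eq_mul]
  exact (hdet.inv.mul (hadj _ _)).mul (hdet.inv.mul (hadj _ _))

/-- The weighted sum of the quadratic forms of the empirical covariances is asymptotically
chi-squared whenever the weights tend to one. -/
theorem tendstoInDistribution_sum_kronQuad (H : IsStandardized P X h) (K : ℕ) {w : ℕ → ℕ → ℝ}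
    (hw : ∀ k, Tendsto (fun N => w N k) atTop (𝓝 1)) :
    TendstoInDistribution (fun (N : ℕ) ω => N * ∑ k ∈ Finset.Icc 1 K,
        w N k * kronQuad (covMat h (fun t => X t ω) N) (covVec h (fun t => X t ω) N k))
      atTop id (fun _ => P) (chiSq (m ^ 2 * K)) := by
  let M : ℕ → Ω → Fin K → Fin m × Fin m → Fin m × Fin m → ℝ := fun N ω k p q =>
    w N (k + 1) * (covMat h (fun t => X t ω) N ⊗ₖ covMat h (fun t => X t ω) N)⁻¹ p q
  let M₀ : Fin K → Fin m × Fin m → Fin m × Fin m → ℝ := fun _ p q => if p = q then 1 else 0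
  -- At the limit matrix `M₀` this is the squared Euclidean norm of the first argument.
  let Φ : EuclideanSpace ℝ (Fin K × (Fin m × Fin m)) ×
      (Fin K → Fin m × Fin m → Fin m × Fin m → ℝ) → ℝ := fun z =>
    ∑ k, ∑ p, ∑ q, z.1 (k, p) * (z.2 k p q * z.1 (k, q))
  have hΦ : Continuous Φ := by fun_prop
  have hMm : ∀ N, Measurable (M N) := fun N => by
    refine measurable_pi_lambda _ fun k => measurable_pi_lambda _ fun p =>
      measurable_pi_lambda _ fun q => Measurable.const_mul ?_ _
    exact measurable_kronecker_inv (A := fun ω => covMat h (fun t => X t ω) N)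
      (fun i j => H.measurable_empCov i j N 0) p q
  have hM : TendstoInMeasure P M atTop fun _ => M₀ := by
    refine tendstoInMeasure_of_tendsto_ae (fun N => (hMm N).aestronglyMeasurable) ?_
    filter_upwards [H.ae_tendsto_covMat] with ω hω
    refine tendsto_pi_nhds.2 fun k => tendsto_pi_nhds.2 fun p => tendsto_pi_nhds.2 fun q => ?_
    simpa [M₀] using (hw (k + 1)).mul (tendsto_kronecker_inv hω p q)
  have hlim := (H.tendstoInDistribution_covVec K).continuous_comp_prodMk_of_tendstoInMeasure_const
    hΦ hM fun N => (hMm N).aemeasurable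
  have hid := tendstoInDistribution_id_of_map_eq (ν := chiSq (m ^ 2 * K)) hlim ?_
  · convert hid using 3 with N ω
    exact mul_sum_kronQuad _ _ _ _ _
  · rw [← stdGaussian_map_sum_sq (ι := Fin K × (Fin m × Fin m)) (by simp; ring)]
    congr 1
    ext z
    simp only [Φ, M₀, id, ite_mul, one_mul, zero_mul, mul_ite, mul_zero, Finset.sum_ite_eq,
      Finset.mem_univ, if_true, sq]
    rw [Fintype.sum_prod_type (f := fun a => z a * z a)]

end IsStandardized

/-! ### Invariance of the statistics under changes of coordinates -/

section Algebra

variable {m : ℕ}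

/-- `(S B Sᵀ)⁻¹ S = (Sᵀ)⁻¹ B⁻¹` holds for singular `B` too, both inverses then being zero. This
matters because an empirical matrix can be singular. -/
lemma dotProduct_inv_mulVec_congr {n : Type*} [Fintype n] [DecidableEq n] {S : Matrix n n ℝ}
    (hS : IsUnit S) (B : Matrix n n ℝ) (v : n → ℝ) :
    (S *ᵥ v) ⬝ᵥ ((S * B * Sᵀ)⁻¹ *ᵥ (S *ᵥ v)) = v ⬝ᵥ (B⁻¹ *ᵥ v) := by
  have hd := (Matrix.isUnit_iff_isUnit_det _).1 hS
  have hmat : (S * B * Sᵀ)⁻¹ * S = (Sᵀ)⁻¹ * B⁻¹ := by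
    rw [Matrix.mul_inv_rev, Matrix.mul_inv_rev, Matrix.mul_assoc, Matrix.mul_assoc,
      Matrix.nonsing_inv_mul _ hd, Matrix.mul_one]
  rw [Matrix.mulVec_mulVec, hmat, Matrix.dotProduct_mulVec, ← Matrix.vecMul_transpose,
    Matrix.vecMul_vecMul, ← Matrix.mul_assoc,
    Matrix.mul_nonsing_inv _ (by rwa [Matrix.det_transpose]), Matrix.one_mul,
    ← Matrix.dotProduct_mulVec]

/-- The quadratic form `v' (A ⊗ A)⁻¹ v` is invariant under an invertible change of coordinates. -/
lemma kronQuad_congr {R : Matrix (Fin m) (Fin m) ℝ} (hR : IsUnit R) (A : Matrix (Fin m) (Fin m) ℝ)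
    (v : Fin m × Fin m → ℝ) :
    kronQuad (R * A * Rᵀ) ((R ⊗ₖ R) *ᵥ v) = kronQuad A v := by
  have hRR : IsUnit (R ⊗ₖ R) := by
    rw [Matrix.isUnit_iff_isUnit_det, Matrix.det_kronecker]
    have := (Matrix.isUnit_iff_isUnit_det _).1 hR
    exact (this.pow _).mul (this.pow _)
  rw [kronQuad, Matrix.mul_kronecker_mul, Matrix.mul_kronecker_mul,
    Matrix.kroneckerMap_transpose, dotProduct_inv_mulVec_congr hRR, kronQuad]

open scoped MatrixOrder in
/-- A positive definite matrix is reduced to the identity by an invertible congruence. -/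
lemma exists_isUnit_mul_mul_transpose_eq_one {Q : Matrix (Fin m) (Fin m) ℝ} (hQ : Q.PosDef) :
    ∃ R : Matrix (Fin m) (Fin m) ℝ, IsUnit R ∧ R * Q * Rᵀ = 1 := by
  obtain ⟨B, hB, rfl⟩ := CStarAlgebra.isStrictlyPositive_iff_eq_star_mul_self.1
    (Matrix.isStrictlyPositive_iff_posDef.2 hQ)
  have hd := (Matrix.isUnit_iff_isUnit_det _).1 hB
  -- With `Q = Bᵀ B`, the choice `R = (Bᵀ)⁻¹` cancels `Bᵀ` on the left and `B` on the right.
  refine ⟨(Bᵀ)⁻¹, ?_, ?_⟩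
  · rw [Matrix.isUnit_iff_isUnit_det, Matrix.det_nonsing_inv, Matrix.det_transpose]
    simpa using hd
  · rw [Matrix.star_eq_conjTranspose, Matrix.conjTranspose_eq_transpose_of_trivial,
      Matrix.transpose_nonsing_inv, Matrix.transpose_transpose, Matrix.mul_assoc, Matrix.mul_assoc,
      Matrix.mul_nonsing_inv _ hd, Matrix.mul_one, Matrix.nonsing_inv_mul _ (by simpa using hd)]

/-- Empirical covariances are equivariant under affine transformations of the functions. -/
lemma empCov_affine (f : Fin m → ℝ → ℝ) (R : Matrix (Fin m) (Fin m) ℝ) (μ : Fin m → ℝ)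
    (x : ℕ → ℝ) (N k : ℕ) (i j : Fin m) :
    empCov k (fun y => ∑ a, R i a * (f a y - μ a)) (fun y => ∑ a, R j a * (f a y - μ a)) x N
      = ∑ a, ∑ b, R i a * R j b * empCov k (f a) (f b) x N := by
  have hmean : 0 < N → ∀ i, empMean (fun y => ∑ a, R i a * (f a y - μ a)) x N
      = ∑ a, R i a * (empMean (f a) x N - μ a) := fun hN i => by
    have hN0 : (N : ℝ) ≠ 0 := by positivity
    simp only [empMean]
    rw [Finset.sum_comm, Finset.mul_sum]
    refine Finset.sum_congr rfl fun a _ => ?_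
    rw [← Finset.mul_sum, Finset.sum_sub_distrib, Finset.sum_const, Finset.card_range,
      nsmul_eq_mul]
    field_simp
  -- For `N = 0` the empirical mean is `0` by default and does not follow the shift by `μ`, but all
  -- the covariance sums are empty.
  rcases Nat.eq_zero_or_pos N with rfl | hN
  · simp [empCov]
  · simp only [empCov, hmean hN, ← Finset.sum_sub_distrib, ← mul_sub, sub_sub_sub_cancel_right]
    simp_rw [Finset.sum_mul_sum, Finset.mul_sum]
    rw [Finset.sum_comm]
    refine Finset.sum_congr rfl fun a _ => ?_
    rw [Finset.sum_comm]
    refine Finset.sum_congr rfl fun b _ => Finset.sum_congr rfl fun t _ => ?_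
    ring

lemma covMat_affine (f : Fin m → ℝ → ℝ) (R : Matrix (Fin m) (Fin m) ℝ) (μ : Fin m → ℝ)
    (x : ℕ → ℝ) (N : ℕ) :
    covMat (fun i y => ∑ a, R i a * (f a y - μ a)) x N = R * covMat f x N * Rᵀ := by
  ext i j
  simp only [covMat, Matrix.of_apply, empCov_affine, Matrix.mul_apply, Matrix.transpose_apply,
    Finset.sum_mul]
  rw [Finset.sum_comm]
  refine Finset.sum_congr rfl fun a _ => Finset.sum_congr rfl fun b _ => ?_
  ring

lemma covVec_affine (f : Fin m → ℝ → ℝ) (R : Matrix (Fin m) (Fin m) ℝ) (μ : Fin m → ℝ)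
    (x : ℕ → ℝ) (N k : ℕ) :
    covVec (fun i y => ∑ a, R i a * (f a y - μ a)) x N k = (R ⊗ₖ R) *ᵥ covVec f x N k := by
  ext p
  simp only [covVec, empCov_affine, Matrix.mulVec, dotProduct, Fintype.sum_prod_type,
    Matrix.kroneckerMap_apply]

lemma kronQuad_eq_zero_of_row {A : Matrix (Fin m) (Fin m) ℝ} {i : Fin m} (hA : ∀ j, A i j = 0)
    (v : Fin m × Fin m → ℝ) : kronQuad A v = 0 := by
  have hdet : A.det = 0 := Matrix.det_eq_zero_of_row_eq_zero i hA
  rw [kronQuad, Matrix.inv_kronecker, Matrix.nonsing_inv_apply_not_isUnit A (by simp [hdet])]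
  simp

/-- The quadratic forms of correlations and of covariances coincide. -/
lemma kronQuad_corr_eq_kronQuad_cov (f : Fin m → ℝ → ℝ) (x : ℕ → ℝ) (N k : ℕ) :
    kronQuad (corrMat f x N) (corrVec f x N k) = kronQuad (covMat f x N) (covVec f x N k) := by
  by_cases hstd : ∀ i, empStd (f i) x N ≠ 0
  · set R : Matrix (Fin m) (Fin m) ℝ := Matrix.diagonal fun i => (empStd (f i) x N)⁻¹ with hR
    have hRu : IsUnit R := by
      rw [Matrix.isUnit_iff_isUnit_det, hR, Matrix.det_diagonal, isUnit_iff_ne_zero]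
      exact Finset.prod_ne_zero_iff.2 fun i _ => inv_ne_zero (hstd i)
    rw [← kronQuad_congr hRu (covMat f x N)]
    congr 1
    · ext i j
      rw [hR, Matrix.diagonal_transpose, Matrix.mul_diagonal, Matrix.diagonal_mul]
      simp only [corrMat, covMat, Matrix.of_apply, empCorr, div_eq_mul_inv, mul_inv]
      ring
    · ext p
      rw [hR, Matrix.diagonal_kronecker_diagonal, Matrix.mulVec_diagonal]
      simp only [corrVec, covVec, empCorr, div_eq_mul_inv, mul_inv]
      ring
  -- A vanishing empirical deviation gives a zero row in both matrices: in `corrMat` because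
  -- division by zero is zero, in `covMat` because `f i` is constant on the sample. Both forms are
  -- then zero.
  · push Not at hstd
    obtain ⟨i, hi⟩ := hstd
    rw [kronQuad_eq_zero_of_row (i := i) fun j => by simp [corrMat, empCorr, hi],
      kronQuad_eq_zero_of_row (i := i) fun j => ?_]
    rcases Nat.eq_zero_or_pos N with rfl | hN
    · simp [covMat, empCov]
    have hsum : ∑ t ∈ Finset.range N, (f i (x t) - empMean (f i) x N) ^ 2 = 0 := by
      have h0 : 0 ≤ ∑ t ∈ Finset.range N, (f i (x t) - empMean (f i) x N) ^ 2 :=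
        Finset.sum_nonneg fun _ _ => sq_nonneg _
      have := (Real.sqrt_eq_zero (by positivity)).1 hi
      have hN0 : (N : ℝ) ≠ 0 := by positivity
      simpa [hN.ne'] using this
    have hz := (Finset.sum_eq_zero_iff_of_nonneg fun _ _ => sq_nonneg _).1 hsum
    simp only [covMat, Matrix.of_apply, empCov, Nat.sub_zero]
    rw [Finset.sum_eq_zero fun t ht => ?_, mul_zero]
    rw [pow_eq_zero_iff (by norm_num) |>.1 (hz t ht), zero_mul]

end Algebra

/-! ### Reduction to the standardized case and conclusion -/

/-- Centering and whitening the functions yields a standardized family. -/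
lemma exists_isStandardized {Ω : Type*} [MeasurableSpace Ω] {P : Measure Ω}
    [IsProbabilityMeasure P] {X : ℕ → Ω → ℝ} (hXm : ∀ i, Measurable (X i))
    (hXindep : iIndepFun X P) (hXident : ∀ i, IdentDistrib (X i) (X 0) P P)
    {m : ℕ} {f : Fin m → ℝ → ℝ} (hfm : ∀ i, Measurable (f i))
    (hf4 : ∀ i, Integrable (fun ω => f i (X 0 ω) ^ 4) P) (hQ : (popCovMat P f (X 0)).PosDef) :
    ∃ (R : Matrix (Fin m) (Fin m) ℝ) (μ : Fin m → ℝ), IsUnit R ∧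
      IsStandardized P X fun i y => ∑ a, R i a * (f a y - μ a) := by
  obtain ⟨R, hRu, hR⟩ := exists_isUnit_mul_mul_transpose_eq_one hQ
  have hmeas : ∀ i, Measurable fun ω => f i (X 0 ω) := fun i => (hfm i).comp (hXm 0)
  have hL4 : ∀ i, MemLp (fun ω => f i (X 0 ω)) 4 P := fun i => by
    rw [← integrable_norm_rpow_iff (hmeas i).aestronglyMeasurable (by norm_num) (by norm_num)]
    refine (hf4 i).congr (ae_of_all _ fun ω => ?_)
    have : ((4 : ENNReal).toReal : ℝ) = (4 : ℕ) := by norm_num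
    simp only [this, Real.rpow_natCast, Real.norm_eq_abs]
    exact (Even.pow_abs (by decide) _).symm
  let μ : Fin m → ℝ := fun a => ∫ ω, f a (X 0 ω) ∂P
  have hc4 : ∀ a, MemLp (fun ω => f a (X 0 ω) - μ a) 4 P := fun a => (hL4 a).sub (memLp_const _)
  have hc2 : ∀ a, MemLp (fun ω => f a (X 0 ω) - μ a) 2 P := fun a =>
    (hc4 a).mono_exponent (by norm_num)
  refine ⟨R, μ, hRu, hXm, hXindep, hXident, fun i => by fun_prop, fun i =>
    memLp_finsetSum _ fun a _ => (hc4 a).const_mul _, fun i => ?_, fun i j => ?_⟩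
  · rw [integral_finsetSum _ fun a _ => ((hc2 a).integrable (by norm_num)).const_mul _]
    refine Finset.sum_eq_zero fun a _ => ?_
    rw [integral_const_mul, integral_sub ((hL4 a).integrable (by norm_num)) (integrable_const _)]
    simp [μ]
  -- The identity `R Q Rᵀ = 1`, read entrywise.
  · have hent : ∑ a, ∑ b, R i a * R j b * popCovMat P f (X 0) a b = if i = j then 1 else 0 := by
      rw [← Matrix.one_apply, ← hR]
      simp only [Matrix.mul_apply, Matrix.transpose_apply, Finset.sum_mul]
      rw [Finset.sum_comm]
      refine Finset.sum_congr rfl fun a _ => Finset.sum_congr rfl fun b _ => ?_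
      ring
    have hi : ∀ a b, Integrable (fun ω => (f a (X 0 ω) - μ a) * (f b (X 0 ω) - μ b)) P :=
      fun a b => (hc2 a).integrable_mul (hc2 b)
    rw [← hent]
    have hexp : ∀ ω, (∑ a, R i a * (f a (X 0 ω) - μ a)) * (∑ a, R j a * (f a (X 0 ω) - μ a))
        = ∑ a, ∑ b, R i a * R j b * ((f a (X 0 ω) - μ a) * (f b (X 0 ω) - μ b)) := fun ω => by
      rw [Finset.sum_mul_sum]
      refine Finset.sum_congr rfl fun a _ => Finset.sum_congr rfl fun b _ => ?_
      ring
    simp_rw [hexp]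
    rw [integral_finsetSum _ fun a _ => integrable_finsetSum _ fun b _ => (hi a b).const_mul _]
    simp_rw [integral_finsetSum _ fun b _ => (hi _ b).const_mul _, integral_const_mul]
    rfl

lemma tendsto_natCast_add_div_natCast_sub (c : ℝ) (k : ℕ) :
    Tendsto (fun N : ℕ => ((N : ℝ) + c) / (N - k)) atTop (𝓝 1) := by
  have h1 : Tendsto (fun N : ℕ => (c + k) / ((N : ℝ) - k)) atTop (𝓝 0) :=
    tendsto_const_nhds.div_atTop
      (tendsto_atTop_add_const_right _ (-(k : ℝ)) tendsto_natCast_atTop_atTop)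
  have h2 := h1.const_add 1
  rw [add_zero] at h2
  refine h2.congr' ?_
  filter_upwards [eventually_gt_atTop k] with N hN
  have : (N : ℝ) - k ≠ 0 := sub_ne_zero.2 (by exact_mod_cast hN.ne')
  field_simp
  ring

end IIDTest
end

theorem corollary8 {Ω : Type*} [MeasurableSpace Ω] (P : Measure Ω) [IsProbabilityMeasure P]
    (X : ℕ → Ω → ℝ) (hXm : ∀ i, Measurable (X i))
    (hXindep : iIndepFun X P) (hXident : ∀ i, IdentDistrib (X i) (X 0) P P)
    (m K : ℕ) (f : Fin m → ℝ → ℝ) (hfm : ∀ i, Measurable (f i))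
    (hf4 : ∀ i, Integrable (fun ω => f i (X 0 ω) ^ 4) P)
    (hQ : (IIDTest.popCovMat P f (X 0)).PosDef)
    (c : ℝ) (hc : 0 < c) :
    (TendstoInDistribution
        (fun N ω => IIDTest.statT K N (IIDTest.corrMat f (fun i => X i ω) N)
          (fun k => IIDTest.corrVec f (fun i => X i ω) N k))
        atTop id (fun _ => P) (IIDTest.chiSq (m ^ 2 * K)) ∧
      TendstoInDistribution
        (fun N ω => IIDTest.statL K N c (IIDTest.corrMat f (fun i => X i ω) N)
          (fun k => IIDTest.corrVec f (fun i => X i ω) N k))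
        atTop id (fun _ => P) (IIDTest.chiSq (m ^ 2 * K))) ∧
    (TendstoInDistribution
        (fun N ω => IIDTest.statT K N (IIDTest.covMat f (fun i => X i ω) N)
          (fun k => IIDTest.covVec f (fun i => X i ω) N k))
        atTop id (fun _ => P) (IIDTest.chiSq (m ^ 2 * K)) ∧
      TendstoInDistribution
        (fun N ω => IIDTest.statL K N c (IIDTest.covMat f (fun i => X i ω) N)
          (fun k => IIDTest.covVec f (fun i => X i ω) N k))
        atTop id (fun _ => P) (IIDTest.chiSq (m ^ 2 * K))) := by
  obtain ⟨R, μ, hR, H⟩ := IIDTest.exists_isStandardized hXm hXindep hXident hfm hf4 hQ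
  have hT := H.tendstoInDistribution_sum_kronQuad K (w := fun _ _ => 1)
    fun _ => tendsto_const_nhds
  have hL := H.tendstoInDistribution_sum_kronQuad K (w := fun N k => ((N : ℝ) + c) / (N - k))
    fun k => IIDTest.tendsto_natCast_add_div_natCast_sub c k
  -- The whitening matrix drops out for every sample, so both limits now concern the original
  -- functions.
  simp only [IIDTest.covMat_affine, IIDTest.covVec_affine, IIDTest.kronQuad_congr hR] at hT hL
  simp only [IIDTest.statT, IIDTest.statL, IIDTest.kronQuad_corr_eq_kronQuad_cov]
  have hT' : TendstoInDistribution (fun (N : ℕ) ω => (N : ℝ) * ∑ k ∈ Finset.Icc 1 K,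
      IIDTest.kronQuad (IIDTest.covMat f (fun i => X i ω) N)
        (IIDTest.covVec f (fun i => X i ω) N k))
      atTop id (fun _ => P) (IIDTest.chiSq (m ^ 2 * K)) := by
    simpa only [one_mul] using hT
  have hL' : TendstoInDistribution (fun (N : ℕ) ω => (N : ℝ) * ((N : ℝ) + c) *
      ∑ k ∈ Finset.Icc 1 K, (1 / ((N : ℝ) - (k : ℝ))) *
        IIDTest.kronQuad (IIDTest.covMat f (fun i => X i ω) N)
          (IIDTest.covVec f (fun i => X i ω) N k))
      atTop id (fun _ => P) (IIDTest.chiSq (m ^ 2 * K)) := by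
    convert hL using 3 with N ω
    rw [mul_assoc, Finset.mul_sum]
    congr 1
    refine Finset.sum_congr rfl fun k _ => ?_
    ring
  exact ⟨⟨hT', hL'⟩, hT', hL'⟩
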